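/- Let $k$ be an algebraically closed field of characteristic $0$, and let $n \ge 1$ and $d \ge 2$ be integers. Let $\overline{\mathrm{End}}{}^n_d$ be the projective space of nonzero $(n+1)$-tuples $f = (f_0 : \dots : f_n)$, up to scaling, of homogeneous forms of degree $d$ in $k[x_0, \dots, x_n]$. Let $\mathrm{End}^n_d \subseteq \overline{\mathrm{End}}{}^n_d$ be the subset of those tuples whose components have no common zero in $\mathbb{P}^n(k)$, i.e. of the endomorphisms $f : \mathbb{P}^n \to \mathbb{P}^n$ of degree $d$, with the induced Zariski topology. A point $P \in \mathbb{P}^n(k)$ is a critical point of $f$ if the Jacobian determinant $\det(\partial f_i / \partial x_j)$ vanishes at $P$, and it is periodic under $f$ if $f^s(P) = P$ for some $s \ge 1$. Then the set $$\{ f \in \mathrm{End}^n_d : f \text{ has a periodic critical point} \}$$ is Zariski dense in $\mathrm{End}^n_d$. -/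

import Mathlib

open LinearAlgebra.Projectivization MvPolynomial

noncomputable section

namespace ProjDyn

/-- A homogeneous polynomial scales by the `m`-th power under scaling of the argument. -/
theorem eval_smul_of_isHomogeneous {k σ : Type*} [Field k] {φ : MvPolynomial σ k} {m : ℕ}
    (hφ : φ.IsHomogeneous m) (c : k) (x : σ → k) :
    eval (c • x) φ = c ^ m * eval x φ := by
  rw [eval_eq, eval_eq, Finset.mul_sum]
  refine Finset.sum_congr rfl fun e he => ?_
  have h := hφ.degree_eq_sum_deg_support he
  simp only [Pi.smul_apply, smul_eq_mul, mul_pow, Finset.prod_mul_distrib,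
    Finset.prod_pow_eq_pow_sum]
  rw [← h]
  ring

/-! ### The Zariski topology on the projective space of a vector space -/

/-- The value at `v : V` of a polynomial in linear functionals on `V`.  On a finite-dimensional
`V` the functions obtained in this way are exactly the polynomial functions on `V`. -/
def evalDual {k V : Type*} [Field k] [AddCommGroup V] [Module k V]
    (φ : MvPolynomial (Module.Dual k V) k) (v : V) : k :=
  eval (fun l : Module.Dual k V => l v) φ

theorem evalDual_smul {k V : Type*} [Field k] [AddCommGroup V] [Module k V]
    {φ : MvPolynomial (Module.Dual k V) k} {m : ℕ} (hφ : φ.IsHomogeneous m) (c : k) (v : V) :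
    evalDual φ (c • v) = c ^ m * evalDual φ v := by
  have : (fun l : Module.Dual k V => l (c • v)) = c • (fun l : Module.Dual k V => l v) := by
    ext l; simp
  rw [evalDual, this, eval_smul_of_isHomogeneous hφ, evalDual]

/-- The common zero locus in `ℙ k V` of a set of polynomials in linear functionals on `V`
(meaningful when these polynomials are homogeneous). -/
def zeroLocus {k V : Type*} [Field k] [AddCommGroup V] [Module k V]
    (S : Set (MvPolynomial (Module.Dual k V) k)) : Set (ℙ k V) :=
  {p | ∀ φ ∈ S, evalDual φ p.rep = 0}

/-- For homogeneous polynomials the zero locus may be computed with any representative. -/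
theorem mk_mem_zeroLocus {k V : Type*} [Field k] [AddCommGroup V] [Module k V]
    {S : Set (MvPolynomial (Module.Dual k V) k)} (hS : ∀ φ ∈ S, ∃ m, φ.IsHomogeneous m)
    (v : V) (hv : v ≠ 0) :
    Projectivization.mk k v hv ∈ zeroLocus S ↔ ∀ φ ∈ S, evalDual φ v = 0 := by
  obtain ⟨a, ha⟩ := Projectivization.exists_smul_eq_mk_rep k v hv
  refine forall₂_congr fun φ hφ => ?_
  obtain ⟨m, hm⟩ := hS φ hφ
  rw [← ha, Units.smul_def, evalDual_smul hm]
  simp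

/-- The Zariski topology on `ℙ k V`: the closed sets are the zero loci of sets of homogeneous
polynomials. -/
abbrev zariskiTopology (k V : Type*) [Field k] [AddCommGroup V] [Module k V] :
    TopologicalSpace (ℙ k V) :=
  TopologicalSpace.ofClosed
    {Z | ∃ S : Set (MvPolynomial (Module.Dual k V) k),
      (∀ φ ∈ S, ∃ m, φ.IsHomogeneous m) ∧ Z = zeroLocus S}
    ⟨{1}, by
      rintro φ rfl
      exact ⟨0, isHomogeneous_one _ _⟩, by
      ext p; simp [zeroLocus, evalDual]⟩
    (by
      intro A hA
      have hA' : ∀ Z ∈ A, ∃ S : Set (MvPolynomial (Module.Dual k V) k),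
          (∀ φ ∈ S, ∃ m, φ.IsHomogeneous m) ∧ Z = zeroLocus S := fun Z h => hA h
      choose! S hS hZ using hA'
      refine ⟨⋃ Z ∈ A, S Z, ?_, ?_⟩
      · intro φ hφ
        simp only [Set.mem_iUnion] at hφ
        obtain ⟨Z, hZA, hφ⟩ := hφ
        exact hS Z hZA φ hφ
      · ext p
        simp only [Set.mem_sInter, zeroLocus, Set.mem_iUnion, Set.mem_ofPred_eq]
        constructor
        · rintro h φ ⟨Z, hZA, hφ⟩
          have := h Z hZA
          rw [hZ Z hZA] at this
          exact this φ hφ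
        · intro h Z hZA
          rw [hZ Z hZA]
          exact fun φ hφ => h φ ⟨Z, hZA, hφ⟩)
    (by
      rintro _ ⟨S, hS, rfl⟩ _ ⟨T, hT, rfl⟩
      refine ⟨{χ | ∃ φ ∈ S, ∃ ψ ∈ T, χ = φ * ψ}, ?_, ?_⟩
      · rintro _ ⟨φ, hφ, ψ, hψ, rfl⟩
        obtain ⟨a, ha⟩ := hS φ hφ
        obtain ⟨b, hb⟩ := hT ψ hψ
        exact ⟨a + b, ha.mul hb⟩
      · ext p
        simp only [Set.mem_union, zeroLocus, Set.mem_ofPred_eq]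
        constructor
        · rintro (h | h) _ ⟨φ, hφ, ψ, hψ, rfl⟩
          · have := h φ hφ
            simp only [evalDual] at this
            simp [evalDual, this]
          · have := h ψ hψ
            simp only [evalDual] at this
            simp [evalDual, this]
        · intro h
          by_contra! hcon
          obtain ⟨⟨φ, hφ, hφ0⟩, ψ, hψ, hψ0⟩ := hcon
          have := h _ ⟨φ, hφ, ψ, hψ, rfl⟩
          simp only [evalDual, map_mul] at this hφ0 hψ0
          exact (mul_ne_zero hφ0 hψ0) this)

/-! ### Endomorphisms of projective space -/

/-- The vector space of `(n+1)`-tuples of forms of degree `d` in `n+1` variables. -/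
abbrev FormTuple (k : Type*) [Field k] (n d : ℕ) : Type _ :=
  Fin (n + 1) → homogeneousSubmodule (Fin (n + 1)) k d

/-- The value of a tuple of forms at a vector. -/
def FormTuple.value {k : Type*} [Field k] {n d : ℕ} (F : FormTuple k n d)
    (x : Fin (n + 1) → k) : Fin (n + 1) → k :=
  fun i => eval x (F i : MvPolynomial (Fin (n + 1)) k)

theorem FormTuple.value_smul {k : Type*} [Field k] {n d : ℕ} (F : FormTuple k n d) (c : k)
    (x : Fin (n + 1) → k) : F.value (c • x) = c ^ d • F.value x := by
  ext i
  exact eval_smul_of_isHomogeneous (F i).2 c x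

theorem FormTuple.smul_value {k : Type*} [Field k] {n d : ℕ} (F : FormTuple k n d) (c : k)
    (x : Fin (n + 1) → k) : FormTuple.value (c • F) x = c • F.value x := by
  ext i
  simp [FormTuple.value, smul_eval]

/-- The Jacobian determinant `det (∂ F_i / ∂ x_j)` of a tuple of forms. -/
def FormTuple.jacobian {k : Type*} [Field k] {n d : ℕ} (F : FormTuple k n d) :
    MvPolynomial (Fin (n + 1)) k :=
  Matrix.det (Matrix.of fun i j : Fin (n + 1) =>
    pderiv j (F i : MvPolynomial (Fin (n + 1)) k))

/-- The parameter space of endomorphisms of degree `d` of projective `n`-space over `k`: tuples of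
forms of degree `d` up to scaling, without common zero in projective space. -/
def EndP (k : Type*) [Field k] (n d : ℕ) : Type _ :=
  {f : ℙ k (FormTuple k n d) //
    ∀ x : Fin (n + 1) → k, x ≠ 0 → FormTuple.value f.rep x ≠ 0}

/-- The Zariski topology on the parameter space, as a subspace of the projective space of
tuples of forms. -/
instance {k : Type*} [Field k] {n d : ℕ} : TopologicalSpace (EndP k n d) :=
  (zariskiTopology k (FormTuple k n d)).induced Subtype.val

/-- The self-map of projective space given by an endomorphism. -/
def EndP.toMap {k : Type*} [Field k] {n d : ℕ} (f : EndP k n d)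
    (P : ℙ k (Fin (n + 1) → k)) : ℙ k (Fin (n + 1) → k) :=
  Projectivization.mk k (FormTuple.value f.1.rep P.rep) (f.2 _ P.rep_nonzero)

/-- `P` is a critical point of `f`, i.e. lies on the zero locus of the Jacobian determinant. -/
def EndP.IsCritical {k : Type*} [Field k] {n d : ℕ} (f : EndP k n d)
    (P : ℙ k (Fin (n + 1) → k)) : Prop :=
  eval P.rep (FormTuple.jacobian f.1.rep) = 0

/-- `P` is periodic under `f`: some iterate `f^s` with `s ≥ 1` fixes `P`. -/
def EndP.IsPeriodic {k : Type*} [Field k] {n d : ℕ} (f : EndP k n d)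
    (P : ℙ k (Fin (n + 1) → k)) : Prop :=
  ∃ s : ℕ, 1 ≤ s ∧ f.toMap^[s] P = P

/-! ### Independence of the chosen representatives -/

theorem value_ne_zero_of_mk {k : Type*} [Field k] {n d : ℕ} (f : EndP k n d)
    (F : FormTuple k n d) (hF : F ≠ 0) (hf : Projectivization.mk k F hF = f.1)
    (x : Fin (n + 1) → k) (hx : x ≠ 0) : F.value x ≠ 0 := by
  obtain ⟨a, ha⟩ := Projectivization.exists_smul_eq_mk_rep k F hF
  intro h
  apply f.2 x hx
  rw [← hf, ← ha, Units.smul_def, FormTuple.smul_value, h, smul_zero]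

theorem EndP.toMap_mk {k : Type*} [Field k] {n d : ℕ} (f : EndP k n d)
    (F : FormTuple k n d) (hF : F ≠ 0) (hf : Projectivization.mk k F hF = f.1)
    (x : Fin (n + 1) → k) (hx : x ≠ 0) :
    f.toMap (Projectivization.mk k x hx) =
      Projectivization.mk k (F.value x) (value_ne_zero_of_mk f F hF hf x hx) := by
  obtain ⟨a, ha⟩ := Projectivization.exists_smul_eq_mk_rep k F hF
  obtain ⟨b, hb⟩ := Projectivization.exists_smul_eq_mk_rep k x hx
  rw [EndP.toMap, Projectivization.mk_eq_mk_iff']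
  refine ⟨(a : k) * (b : k) ^ d, ?_⟩
  rw [← hf, ← ha, ← hb, Units.smul_def, Units.smul_def, FormTuple.smul_value,
    FormTuple.value_smul, smul_smul]

theorem FormTuple.jacobian_isHomogeneous {k : Type*} [Field k] {n d : ℕ}
    (F : FormTuple k n d) : F.jacobian.IsHomogeneous ((n + 1) * (d - 1)) := by
  rw [FormTuple.jacobian, Matrix.det_apply]
  refine IsHomogeneous.sum _ _ _ fun σ _ => ?_
  refine (homogeneousSubmodule (Fin (n + 1)) k _).smul_of_tower_mem _ ?_
  have := IsHomogeneous.prod (Finset.univ : Finset (Fin (n + 1)))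
    (fun i => pderiv i (F (σ i) : MvPolynomial (Fin (n + 1)) k)) (fun _ => d - 1)
    (fun i _ => IsHomogeneous.pderiv (F (σ i)).2)
  simpa using this

theorem FormTuple.jacobian_smul {k : Type*} [Field k] {n d : ℕ} (c : k)
    (F : FormTuple k n d) : FormTuple.jacobian (c • F) = c ^ (n + 1) • F.jacobian := by
  have : (Matrix.of fun i j : Fin (n + 1) =>
      pderiv j (((c • F) i : homogeneousSubmodule (Fin (n + 1)) k d) :
        MvPolynomial (Fin (n + 1)) k)) =
      c • Matrix.of fun i j : Fin (n + 1) => pderiv j (F i : MvPolynomial (Fin (n + 1)) k) := by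
    ext1 i j
    simp
  rw [FormTuple.jacobian, this, Matrix.det_smul_of_tower, FormTuple.jacobian]
  simp

theorem EndP.isCritical_mk {k : Type*} [Field k] {n d : ℕ} (f : EndP k n d)
    (F : FormTuple k n d) (hF : F ≠ 0) (hf : Projectivization.mk k F hF = f.1)
    (x : Fin (n + 1) → k) (hx : x ≠ 0) :
    f.IsCritical (Projectivization.mk k x hx) ↔ eval x F.jacobian = 0 := by
  obtain ⟨a, ha⟩ := Projectivization.exists_smul_eq_mk_rep k F hF
  obtain ⟨b, hb⟩ := Projectivization.exists_smul_eq_mk_rep k x hx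
  rw [EndP.IsCritical, ← hf, ← ha, ← hb, Units.smul_def, Units.smul_def,
    FormTuple.jacobian_smul, smul_eval,
    eval_smul_of_isHomogeneous F.jacobian_isHomogeneous]
  simp

end ProjDyn

end

/-! It suffices that a polynomial function `φ` vanishing on all tuples with a critical cycle
vanishes identically (`evalDual_eq_zero_of_hasCriticalCycle`). A Macaulay minor, nonzero at
`powerTuple` and only at tuples without common zero, then passes from tuples to endomorphisms:
multiplying `φ` by it reduces the test to genuine endomorphisms.

The one-variable input is the family `z ^ d - d * z + t`, with critical point `1`. The condition
that `1` be periodic has only simple roots `t`, because the `t`-derivative is `1` plus `d` times an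
algebraic integer; hence infinitely many `t` occur (`infinite_critOrbit_periodic`). Put this
polynomial, homogenized by `x_o`, in one coordinate `z` and `d`-th powers in the others. At each
such `t` the equations for a critical cycle through `(1, …, 1)` form a square system without nonzero
tangent vector (`tangent_basePoint_eq_zero`).

Let `F` be any tuple, `v` and `h` the base and direction tuples, and `g = F - v`. Hensel lifting
along `v + T • h + e • g` gives a power series `T(e)` with `T(0) = t` at which a formal critical
cycle persists, and the Nullstellensatz yields `φ (v + T(e) • h + e • g) = 0`. As a polynomial in
`T` over `k[[e]]` this has infinitely many roots, so it is zero; setting `T = 0`, then `e = 1`,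
gives `φ F = 0`. -/

namespace ProjDyn

/-! ### Periodic critical orbits of the polynomials `z ^ d - d * z + t` -/

/-- The orbit of the critical point `1` of `z ^ d - d * z + t`, as polynomials in `t`. -/
noncomputable def critOrbit (d : ℕ) : ℕ → Polynomial ℤ
  | 0 => 1
  | s + 1 => critOrbit d s ^ d - (d : Polynomial ℤ) * critOrbit d s + Polynomial.X

/-- The linear coefficient `-d` makes `1` critical and also makes every term of the recursion except
`X` have derivative divisible by `d`. -/
theorem derivative_critOrbit_succ (d s : ℕ) :
    ∃ r : Polynomial ℤ, Polynomial.derivative (critOrbit d (s + 1)) = 1 + (d : Polynomial ℤ) * r := by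
  refine ⟨(critOrbit d s ^ (d - 1) - 1) * Polynomial.derivative (critOrbit d s), ?_⟩
  simp only [critOrbit, Polynomial.derivative_add, Polynomial.derivative_sub,
    Polynomial.derivative_pow, Polynomial.derivative_mul, Polynomial.derivative_natCast,
    Polynomial.derivative_X]
  simp
  ring

theorem monic_natDegree_critOrbit_succ (d : ℕ) (hd : 2 ≤ d) (s : ℕ) :
    (critOrbit d (s + 1)).Monic ∧ (critOrbit d (s + 1)).natDegree = d ^ s := by
  induction s with
  | zero =>
    have : critOrbit d (0 + 1) = Polynomial.X + Polynomial.C (1 - (d : ℤ)) := by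
      simp [critOrbit]; ring
    rw [this]
    exact ⟨Polynomial.monic_X_add_C _, by rw [Polynomial.natDegree_X_add_C, pow_zero]⟩
  | succ s ih =>
    obtain ⟨hm, hn⟩ := ih
    have hpos : 1 ≤ d ^ s := Nat.one_le_pow _ _ (by omega)
    have hlt : d ^ s < d ^ (s + 1) := Nat.pow_lt_pow_right (by omega) (by omega)
    have hm' : (critOrbit d (s + 1) ^ d).Monic := hm.pow d
    have hn' : (critOrbit d (s + 1) ^ d).natDegree = d ^ (s + 1) := by
      rw [hm.natDegree_pow, hn, pow_succ]; ring
    have hr : critOrbit d (s + 1 + 1) = critOrbit d (s + 1) ^ d +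
        (Polynomial.X - (d : Polynomial ℤ) * critOrbit d (s + 1)) := by
      rw [critOrbit]; ring
    have hb : (Polynomial.X - (d : Polynomial ℤ) * critOrbit d (s + 1)).natDegree ≤ d ^ s := by
      refine (Polynomial.natDegree_sub_le _ _).trans (max_le (by simpa using hpos) ?_)
      refine Polynomial.natDegree_mul_le.trans ?_
      simp [hn]
    have hdeg : (Polynomial.X - (d : Polynomial ℤ) * critOrbit d (s + 1)).degree <
        (critOrbit d (s + 1) ^ d).degree := by
      rw [Polynomial.degree_eq_natDegree hm'.ne_zero, hn']
      exact (Polynomial.natDegree_le_iff_degree_le.1 hb).trans_lt (by exact_mod_cast hlt)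
    rw [hr]
    refine ⟨hm'.add_of_left hdeg, ?_⟩
    rw [Polynomial.natDegree_add_eq_left_of_degree_lt hdeg, hn']

theorem monic_natDegree_critOrbit_sub_one (d : ℕ) (hd : 2 ≤ d) (s : ℕ) :
    (critOrbit d (s + 1) - 1).Monic ∧ (critOrbit d (s + 1) - 1).natDegree = d ^ s := by
  obtain ⟨hm, hn⟩ := monic_natDegree_critOrbit_succ d hd s
  have hpos : 1 ≤ d ^ s := Nat.one_le_pow _ _ (by omega)
  have hdeg : (-1 : Polynomial ℤ).degree < (critOrbit d (s + 1)).degree := by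
    rw [Polynomial.degree_eq_natDegree hm.ne_zero, hn, Polynomial.degree_neg, Polynomial.degree_one]
    exact_mod_cast hpos
  rw [sub_eq_add_neg]
  exact ⟨hm.add_of_left hdeg, by rw [Polynomial.natDegree_add_eq_left_of_degree_lt hdeg, hn]⟩

/-- Otherwise `-1 / d` would be a rational algebraic integer, hence an integer. -/
theorem one_add_natCast_mul_ne_zero {k : Type*} [Field k] [CharZero k] (d : ℕ) (hd : 2 ≤ d)
    (u : k) (hu : IsIntegral ℤ u) : 1 + (d : k) * u ≠ 0 := by
  intro h
  have hd0 : (d : k) ≠ 0 := by exact_mod_cast (by omega : d ≠ 0)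
  have hq : algebraMap ℚ k (-1 / d) = u := by
    simp only [map_div₀, map_neg, map_one, map_natCast]
    field_simp
    linear_combination -h
  rw [← hq, isIntegral_algebraMap_iff (algebraMap ℚ k).injective,
    IsIntegrallyClosed.isIntegral_iff] at hu
  obtain ⟨m, hm⟩ := hu
  have hdq : (d : ℚ) ≠ 0 := by exact_mod_cast (by omega : d ≠ 0)
  simp only [algebraMap_int_eq, eq_intCast] at hm
  field_simp at hm
  have h1 : m * (d : ℤ) = -1 := by exact_mod_cast hm
  have h2 : (d : ℤ) ∣ 1 := ⟨-m, by linarith⟩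
  have := Int.le_of_dvd one_pos h2
  omega

/-- Here `t` is a root of the monic integer polynomial `critOrbit d (s + 1) - 1`, so every integer
polynomial in `t` is integral. -/
theorem aeval_derivative_critOrbit_ne_zero {k : Type*} [Field k] [CharZero k] (d : ℕ)
    (hd : 2 ≤ d) (s : ℕ) (t : k) (ht : Polynomial.aeval t (critOrbit d (s + 1)) = 1) :
    Polynomial.aeval t (Polynomial.derivative (critOrbit d (s + 1))) ≠ 0 := by
  obtain ⟨r, hr⟩ := derivative_critOrbit_succ d s
  have hint : IsIntegral ℤ t :=
    ⟨critOrbit d (s + 1) - 1, (monic_natDegree_critOrbit_sub_one d hd s).1, by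
      rw [← Polynomial.aeval_def, map_sub, ht, map_one, sub_self]⟩
  have hri : IsIntegral ℤ (Polynomial.aeval t r) :=
    IsIntegral.of_mem_of_fg _ hint.fg_adjoin_singleton _ (Polynomial.aeval_mem_adjoin_singleton ℤ t)
  rw [hr]
  simpa using one_add_natCast_mul_ne_zero d hd _ hri

/-- There are infinitely many parameters for which the critical point `1` is periodic. -/
theorem infinite_critOrbit_periodic (k : Type*) [Field k] [IsAlgClosed k] [CharZero k] (d : ℕ)
    (hd : 2 ≤ d) : {t : k | ∃ s, Polynomial.aeval t (critOrbit d (s + 1)) = 1}.Infinite := by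
  classical
  intro hfin
  obtain ⟨s, hs⟩ : ∃ s, hfin.toFinset.card < d ^ s :=
    ⟨_, Nat.lt_pow_self (by omega)⟩
  obtain ⟨hm, hn⟩ := monic_natDegree_critOrbit_sub_one d hd s
  set p : Polynomial k := (critOrbit d (s + 1) - 1).map (algebraMap ℤ k) with hp
  have hpm : p.Monic := hm.map _
  have hroot : ∀ t, p.IsRoot t → Polynomial.aeval t (critOrbit d (s + 1)) = 1 := by
    intro t ht
    rw [hp, Polynomial.IsRoot.def, Polynomial.eval_map_algebraMap, map_sub, map_one] at ht
    exact sub_eq_zero.1 ht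
  -- All roots are simple, so there are `d ^ s` distinct ones, more than the supposed finite total.
  have hnodup : p.roots.Nodup := by
    rw [Multiset.nodup_iff_count_le_one]
    intro t
    rw [Polynomial.count_roots]
    by_contra! hlt
    obtain ⟨h1, h2⟩ := (Polynomial.one_lt_rootMultiplicity_iff_isRoot hpm.ne_zero).1 hlt
    refine aeval_derivative_critOrbit_ne_zero d hd s t (hroot t h1) ?_
    rw [hp, Polynomial.derivative_map, Polynomial.IsRoot.def, Polynomial.eval_map_algebraMap] at h2
    simpa using h2
  have hcard : p.roots.toFinset.card = d ^ s := by
    rw [Multiset.toFinset_card_of_nodup hnodup, IsAlgClosed.card_roots_eq_natDegree, hp,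
      hm.natDegree_map, hn]
  have hsub : p.roots.toFinset ⊆ hfin.toFinset := by
    intro t ht
    rw [Multiset.mem_toFinset, Polynomial.mem_roots hpm.ne_zero] at ht
    rw [Set.Finite.mem_toFinset]
    exact ⟨s, hroot t ht⟩
  have := Finset.card_le_card hsub
  omega

/-! ### Taylor expansion and Hensel lifting for polynomial systems -/

/-- Taylor expansion to first order. It serves with `δ ^ 2 = 0` in the dual numbers and with `δ` a
power of `X` in the Newton steps. -/
theorem aeval_add_mul_eq {ρ k B : Type*} [Fintype ρ] [CommRing k] [CommRing B] [Algebra k B]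
    (p : MvPolynomial ρ k) (u b : ρ → B) (δ : B) :
    ∃ c : B, aeval (fun i => u i + δ * b i) p =
      aeval u p + δ * ∑ i, b i * aeval u (pderiv i p) + δ ^ 2 * c := by
  classical
  induction p using MvPolynomial.induction_on with
  | C a => exact ⟨0, by simp⟩
  | add p q hp hq =>
    obtain ⟨c, hc⟩ := hp
    obtain ⟨e, he⟩ := hq
    refine ⟨c + e, ?_⟩
    simp only [map_add, hc, he, mul_add, Finset.sum_add_distrib]
    ring
  | mul_X p j hp =>
    obtain ⟨c, hc⟩ := hp
    have hs : ∑ i, b i * aeval u (pderiv i (p * X j)) =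
        u j * ∑ i, b i * aeval u (pderiv i p) + b j * aeval u p := by
      simp only [Derivation.leibniz, pderiv_X, smul_eq_mul, map_add, map_mul, aeval_X, mul_add,
        Finset.sum_add_distrib, Finset.mul_sum]
      rw [add_comm]
      congr 1
      · exact Finset.sum_congr rfl fun i _ => by ring
      · rw [Finset.sum_eq_single j]
        · simp
        · intro i _ hij
          simp [hij.symm]
        · simp
    refine ⟨c * (u j + δ * b j) + b j * ∑ i, b i * aeval u (pderiv i p), ?_⟩
    rw [hs, map_mul, hc, map_mul, aeval_X, aeval_X]
    ring

/-- Hensel's lemma for a square system of polynomials over `k`, in unknowns `τ` and one parameter,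
at a zero over the parameter `0` where the system has no nonzero tangent vector: the zero lifts
to power series in the parameter. -/
theorem exists_powerSeries_zero {τ k : Type*} [Fintype τ] [Field k]
    (G : τ → MvPolynomial (Option τ) k) (a : τ → k)
    (h0 : ∀ j, aeval (fun o : Option τ => o.elim 0 a) (G j) = 0)
    (hinj : ∀ b : τ → k, (∀ j, aeval (fun o : Option τ =>
      o.elim (0 : DualNumber k) fun i => TrivSqZeroExt.inl (a i) + TrivSqZeroExt.inr (b i)) (G j) = 0) →
      b = 0) :
    ∃ u : τ → PowerSeries k, (∀ i, PowerSeries.constantCoeff (u i) = a i) ∧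
      ∀ j, aeval (fun o : Option τ => o.elim (PowerSeries.X : PowerSeries k) u) (G j) = 0 := by
  classical
  let L : (τ → k) →ₗ[k] (τ → k) := LinearMap.pi fun j =>
    ∑ i, (aeval (fun o : Option τ => o.elim 0 a) (pderiv (some i) (G j)) : k) • LinearMap.proj i
  have hL : ∀ b j, L b j =
      ∑ i, b i * aeval (fun o : Option τ => o.elim 0 a) (pderiv (some i) (G j)) := by
    intro b j
    simp [L, mul_comm]
  have hLinj : Function.Injective L := by
    rw [← LinearMap.ker_eq_bot, LinearMap.ker_eq_bot']
    intro b hb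
    refine hinj b fun j => ?_
    obtain ⟨c, hc⟩ := aeval_add_mul_eq (G j)
      (fun o : Option τ => algebraMap k (DualNumber k) (o.elim 0 a))
      (fun o : Option τ => algebraMap k (DualNumber k) (o.elim 0 b)) DualNumber.eps
    have e1 : (fun o : Option τ => o.elim (0 : DualNumber k)
        fun i => TrivSqZeroExt.inl (a i) + TrivSqZeroExt.inr (b i)) =
        fun o : Option τ => algebraMap k (DualNumber k) (o.elim 0 a) +
          DualNumber.eps * algebraMap k (DualNumber k) (o.elim 0 b) := by
      funext o
      cases o with
      | none => simp
      | some i =>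
        ext <;> simp [TrivSqZeroExt.algebraMap_eq_inl]
    rw [e1, hc, pow_two, DualNumber.eps_mul_eps, zero_mul, add_zero]
    have e2 : ∀ q : MvPolynomial (Option τ) k,
        aeval (fun o : Option τ => algebraMap k (DualNumber k) (o.elim 0 a)) q =
        algebraMap k (DualNumber k) (aeval (fun o : Option τ => o.elim 0 a) q) := fun q =>
      aeval_algebraMap_apply _ _ q
    simp only [e2, h0, map_zero, zero_add, ← map_mul, ← map_sum, Fintype.sum_option, Option.elim_none, Option.elim_some]
    rw [zero_mul, zero_add]
    have := congrFun hb j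
    rw [hL] at this
    simp only [Pi.zero_apply] at this
    rw [this, map_zero, mul_zero]
  have hLsurj : Function.Surjective L := LinearMap.injective_iff_surjective.1 hLinj
  have hconst : ∀ (u : τ → PowerSeries k), (∀ i, PowerSeries.constantCoeff (u i) = a i) →
      ∀ q : MvPolynomial (Option τ) k,
        PowerSeries.constantCoeff (aeval (fun o : Option τ => o.elim (PowerSeries.X : PowerSeries k) u) q) =
          aeval (fun o : Option τ => o.elim 0 a) q := by
    intro u hu q
    let φ : PowerSeries k →ₐ[k] k := ⟨PowerSeries.constantCoeff, fun r => by simp⟩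
    change φ _ = _
    rw [← AlgHom.comp_apply, MvPolynomial.comp_aeval]
    congr 2
    funext o
    cases o with
    | none => exact PowerSeries.constantCoeff_X
    | some i => exact hu i
  -- one step of the approximation
  have hstep : ∀ (n : ℕ) (u : τ → PowerSeries k), (∀ i, PowerSeries.constantCoeff (u i) = a i) →
      (∀ j, PowerSeries.X ^ (n + 1) ∣ aeval (fun o : Option τ => o.elim (PowerSeries.X : PowerSeries k) u) (G j)) →
      ∃ b : τ → k, ∀ j, PowerSeries.X ^ (n + 2) ∣ aeval (fun o : Option τ => o.elim (PowerSeries.X : PowerSeries k)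
        fun i => u i + PowerSeries.X ^ (n + 1) * PowerSeries.C (b i)) (G j) := by
    intro n u hu hdiv
    choose e he using hdiv
    -- The correction cancels the leading error coefficient; the quadratic error is divisible by `X
    -- ^ (2 * (n + 1))`, hence by `X ^ (n + 2)`.
    obtain ⟨b, hb⟩ := hLsurj fun j => - PowerSeries.constantCoeff (e j)
    refine ⟨b, fun j => ?_⟩
    obtain ⟨c, hc⟩ := aeval_add_mul_eq (G j) (fun o : Option τ => o.elim (PowerSeries.X : PowerSeries k) u)
      (fun o : Option τ => o.elim 0 fun i => PowerSeries.C (b i)) (PowerSeries.X ^ (n + 1))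
    have e1 : (fun o : Option τ => o.elim (PowerSeries.X : PowerSeries k) fun i => u i + PowerSeries.X ^ (n + 1) * PowerSeries.C (b i)) =
        fun o : Option τ => o.elim (PowerSeries.X : PowerSeries k) u +
          PowerSeries.X ^ (n + 1) * o.elim 0 fun i => PowerSeries.C (b i) := by
      funext o
      cases o <;> simp
    rw [e1, hc, he, ← mul_add]
    refine dvd_add ?_ ?_
    · rw [pow_succ PowerSeries.X (n + 1)]
      refine mul_dvd_mul_left _ ?_
      rw [PowerSeries.X_dvd_iff, map_add, map_sum, Fintype.sum_option]
      simp only [map_mul, hconst u hu, Option.elim_none, Option.elim_some, map_zero, zero_mul, zero_add, PowerSeries.constantCoeff_C]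
      have := congrFun hb j
      rw [hL] at this
      rw [this, add_neg_cancel]
    · rw [← pow_mul]
      exact Dvd.dvd.mul_right (pow_dvd_pow _ (by omega)) _
  choose! b hb using hstep
  let u : ℕ → τ → PowerSeries k := fun n => Nat.rec (fun i => PowerSeries.C (a i))
    (fun n v i => v i + PowerSeries.X ^ (n + 1) * PowerSeries.C (b n v i)) n
  have hu_succ : ∀ n i, u (n + 1) i = u n i + PowerSeries.X ^ (n + 1) * PowerSeries.C (b n (u n) i) := fun n i => rfl
  have hu : ∀ n, (∀ i, PowerSeries.constantCoeff (u n i) = a i) ∧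
      ∀ j, PowerSeries.X ^ (n + 1) ∣ aeval (fun o : Option τ => o.elim (PowerSeries.X : PowerSeries k) (u n)) (G j) := by
    intro n
    induction n with
    | zero =>
      have h1 : ∀ i, PowerSeries.constantCoeff (u 0 i) = a i := fun i => PowerSeries.constantCoeff_C _
      refine ⟨h1, fun j => ?_⟩
      rw [zero_add, pow_one, PowerSeries.X_dvd_iff, hconst _ h1, h0]
    | succ n ih =>
      refine ⟨fun i => ?_, fun j => hb n (u n) ih.1 ih.2 j⟩
      rw [hu_succ, map_add, ih.1]
      simp
  have hcoeff : ∀ n m i, m ≤ n → PowerSeries.coeff m (u n i) = PowerSeries.coeff m (u m i) := by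
    intro n m i hmn
    induction n, hmn using Nat.le_induction with
    | base => rfl
    | succ n hmn ih =>
      rw [hu_succ, map_add, ih, PowerSeries.coeff_X_pow_mul', if_neg (by omega), add_zero]
  -- Diagonal limit: the coefficient of index `n` no longer changes from `u n` on.
  let U : τ → PowerSeries k := fun i => PowerSeries.mk fun n => PowerSeries.coeff n (u n i)
  refine ⟨U, fun i => ?_, fun j => ?_⟩
  · rw [← PowerSeries.coeff_zero_eq_constantCoeff_apply, PowerSeries.coeff_mk, PowerSeries.coeff_zero_eq_constantCoeff_apply]
    exact (hu 0).1 i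
  · ext n
    have hdiv : ∀ i, PowerSeries.X ^ (n + 1) ∣ U i - u n i := by
      intro i
      rw [PowerSeries.X_pow_dvd_iff]
      intro m hm
      rw [map_sub, PowerSeries.coeff_mk, hcoeff n m i (by omega), sub_self]
    choose v hv using hdiv
    obtain ⟨c, hc⟩ := aeval_add_mul_eq (G j) (fun o : Option τ => o.elim (PowerSeries.X : PowerSeries k) (u n))
      (fun o : Option τ => o.elim 0 v) (PowerSeries.X ^ (n + 1))
    have e1 : (fun o : Option τ => o.elim (PowerSeries.X : PowerSeries k) U) =
        fun o : Option τ => o.elim (PowerSeries.X : PowerSeries k) (u n) + PowerSeries.X ^ (n + 1) * o.elim 0 v := by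
      funext o
      cases o with
      | none => simp
      | some i =>
        simp only [Option.elim_some]
        rw [← hv i]; ring
    have hd : PowerSeries.X ^ (n + 1) ∣ aeval (fun o : Option τ => o.elim (PowerSeries.X : PowerSeries k) U) (G j) := by
      rw [e1, hc]
      refine dvd_add (dvd_add ((hu n).2 j) (dvd_mul_right _ _)) ?_
      rw [← pow_mul]
      exact Dvd.dvd.mul_right (pow_dvd_pow _ (by omega)) _
    rw [map_zero]
    exact PowerSeries.X_pow_dvd_iff.1 hd n (by omega)

/-! ### Specialization to points over an algebraically closed field -/

/-- The relations among the `r i` form a prime ideal not containing `H`; by the Nullstellensatz some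
`k`-point of its zero locus avoids `H = 0`. -/
theorem exists_specialization {k ρ R : Type*} [Field k] [IsAlgClosed k] [Finite ρ] [CommRing R]
    [IsDomain R] [Algebra k R] (r : ρ → R) (H : MvPolynomial ρ k) (hH : aeval r H ≠ 0) :
    ∃ r₀ : ρ → k, aeval r₀ H ≠ 0 ∧ ∀ p : MvPolynomial ρ k, aeval r p = 0 → aeval r₀ p = 0 := by
  let I : Ideal (MvPolynomial ρ k) := RingHom.ker (aeval r : MvPolynomial ρ k →ₐ[k] R)
  have hI : I.IsPrime := RingHom.ker_isPrime _
  have hHI : H ∉ vanishingIdeal k (MvPolynomial.zeroLocus k I) := by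
    rw [IsPrime.vanishingIdeal_zeroLocus]
    exact hH
  rw [mem_vanishingIdeal_iff] at hHI
  push Not at hHI
  obtain ⟨r₀, hr₀, hne⟩ := hHI
  exact ⟨r₀, hne, fun p hp => hr₀ p hp⟩

/-! ### Polynomial functions on a three-parameter family of vectors -/

/-- The value of the polynomial function `φ` at the vector `v + t • h + e • g`, with parameters
`t` and `e` in an algebra. -/
noncomputable def evalFamily {k V B : Type*} [Field k] [AddCommGroup V] [Module k V] [CommRing B]
    [Algebra k B] (φ : MvPolynomial (Module.Dual k V) k) (v h g : V) (t e : B) : B :=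
  aeval (fun l : Module.Dual k V =>
    algebraMap k B (l v) + t * algebraMap k B (l h) + e * algebraMap k B (l g)) φ

section evalFamily

variable {k V B B' : Type*} [Field k] [AddCommGroup V] [Module k V] [CommRing B] [Algebra k B]
  [CommRing B'] [Algebra k B']

/-- Naturality in the parameters lets one identity be moved between polynomials, power series and
`k`. -/
theorem map_evalFamily (f : B →ₐ[k] B') (φ : MvPolynomial (Module.Dual k V) k) (v h g : V)
    (t e : B) : f (evalFamily φ v h g t e) = evalFamily φ v h g (f t) (f e) := by
  rw [evalFamily, ← AlgHom.comp_apply, comp_aeval, evalFamily]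
  simp

theorem evalFamily_eq_evalDual (φ : MvPolynomial (Module.Dual k V) k) (v h g : V) (t e : k) :
    evalFamily φ v h g t e = evalDual φ (v + t • h + e • g) := by
  rw [evalFamily, evalDual, ← coe_aeval_eq_eval]
  simp

/-- The product of two nonzero polynomial functions is nonzero. -/
theorem exists_evalDual_mul_ne_zero [Infinite k] (φ ψ : MvPolynomial (Module.Dual k V) k)
    (v w : V) (hv : evalDual φ v ≠ 0) (hw : evalDual ψ w ≠ 0) :
    ∃ x, evalDual (φ * ψ) x ≠ 0 := by
  by_contra! hcon
  -- Restriction to the line through `v` and `w` lands in the domain `k[X]`.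
  let P : MvPolynomial (Module.Dual k V) k → Polynomial k := fun χ =>
    evalFamily χ v (w - v) 0 Polynomial.X 0
  have hP : ∀ (χ) (t : k), (P χ).eval t = evalDual χ (v + t • (w - v)) := by
    intro χ t
    rw [← Polynomial.coe_aeval_eq_eval]
    simp only [P]
    rw [map_evalFamily, evalFamily_eq_evalDual]
    simp
  have hmul : P φ * P ψ = 0 := by
    refine Polynomial.funext fun t => ?_
    have := hcon (v + t • (w - v))
    rw [Polynomial.eval_mul, hP, hP, Polynomial.eval_zero, ← this]
    simp [evalDual]
  rcases mul_eq_zero.1 hmul with h | h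
  · apply hv
    have := hP φ 0
    rw [h] at this
    simpa using this.symm
  · apply hw
    have := hP ψ 1
    rw [h] at this
    simpa using this.symm

end evalFamily

/-! ### Tuples of forms without common zero -/

/-- The tuple `(x_0 ^ d, …, x_n ^ d)`. -/
noncomputable def powerTuple (k : Type*) [Field k] (n d : ℕ) : FormTuple k n d :=
  fun i => ⟨X i ^ d, isHomogeneous_X_pow i d⟩

/-- The exponents of the monomials of degree `m` in `n + 1` variables. -/
abbrev Exponents (n m : ℕ) : Type := ↥(Finset.finsuppAntidiag (Finset.univ : Finset (Fin (n + 1))) m)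

/-- The coefficient of `e'` in the product of the `i`-th component of a tuple with the monomial
with exponent `e`, as a linear functional. -/
noncomputable def coeffMulFunctional (k : Type*) [Field k] (n d : ℕ) (i : Fin (n + 1))
    (e e' : Fin (n + 1) →₀ ℕ) : Module.Dual k (FormTuple k n d) where
  toFun F := coeff e' (monomial e 1 * (F i : MvPolynomial (Fin (n + 1)) k))
  map_add' F F' := by simp [mul_add]
  map_smul' c F := by simp

theorem exists_le_exponent (n d : ℕ) (e : Exponents n ((n + 1) * d)) : ∃ i, d ≤ e.1 i := by
  have he := (Finset.mem_finsuppAntidiag.1 e.2).1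
  by_contra! hcon
  have : ∑ i : Fin (n + 1), e.1 i < ∑ i : Fin (n + 1), d :=
    Finset.sum_lt_sum_of_nonempty Finset.univ_nonempty fun i _ => hcon i
  rw [he] at this
  simp at this

/-- A variable occurring with exponent at least `d` in a given monomial. -/
noncomputable def bigVariable (n d : ℕ) (e : Exponents n ((n + 1) * d)) : Fin (n + 1) :=
  (exists_le_exponent n d e).choose

theorem le_bigVariable (n d : ℕ) (e : Exponents n ((n + 1) * d)) : d ≤ e.1 (bigVariable n d e) :=
  (exists_le_exponent n d e).choose_spec

theorem single_bigVariable_le (n d : ℕ) (e : Exponents n ((n + 1) * d)) :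
    Finsupp.single (bigVariable n d e) d ≤ e.1 :=
  Finsupp.single_le_iff.2 (le_bigVariable n d e)

/-- A minor of the Macaulay matrix, as a polynomial in linear functionals on tuples of forms. -/
noncomputable def macaulayMinor (k : Type*) [Field k] (n d : ℕ) :
    MvPolynomial (Module.Dual k (FormTuple k n d)) k :=
  Matrix.det (Matrix.of fun e e' : Exponents n ((n + 1) * d) =>
    X (coeffMulFunctional k n d (bigVariable n d e)
      (e.1 - Finsupp.single (bigVariable n d e) d) e'.1))

theorem evalDual_macaulayMinor {k : Type*} [Field k] {n d : ℕ} (F : FormTuple k n d) :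
    evalDual (macaulayMinor k n d) F =
      Matrix.det (Matrix.of fun e e' : Exponents n ((n + 1) * d) =>
        coeffMulFunctional k n d (bigVariable n d e)
          (e.1 - Finsupp.single (bigVariable n d e) d) e'.1 F) := by
  rw [evalDual, macaulayMinor, RingHom.map_det]
  congr 1
  ext e e'
  simp

/-- For pure powers, the row of `e` is the monomial `e` itself, so the matrix is the identity. -/
theorem evalDual_macaulayMinor_powerTuple (k : Type*) [Field k] (n d : ℕ) :
    evalDual (macaulayMinor k n d) (powerTuple k n d) ≠ 0 := by
  rw [evalDual_macaulayMinor]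
  have : (Matrix.of fun e e' : Exponents n ((n + 1) * d) =>
        coeffMulFunctional k n d (bigVariable n d e)
          (e.1 - Finsupp.single (bigVariable n d e) d) e'.1 (powerTuple k n d)) = 1 := by
    ext e e'
    simp only [Matrix.of_apply, coeffMulFunctional, LinearMap.coe_mk, AddHom.coe_mk, powerTuple]
    rw [X_pow_eq_monomial, monomial_mul, one_mul, tsub_add_cancel_of_le (single_bigVariable_le n d e),
      coeff_monomial, Matrix.one_apply]
    simp only [Subtype.ext_iff]
  rw [this, Matrix.det_one]
  exact one_ne_zero

/-- At a common zero `y`, the vector of all monomials of degree `(n + 1) * d` at `y` lies in the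
kernel of the matrix; it is nonzero because it contains pure powers of the coordinates. -/
theorem value_ne_zero_of_macaulayMinor {k : Type*} [Field k] {n d : ℕ} (F : FormTuple k n d)
    (hF : evalDual (macaulayMinor k n d) F ≠ 0) (y : Fin (n + 1) → k) (hy : y ≠ 0) :
    F.value y ≠ 0 := by
  intro hzero
  rw [evalDual_macaulayMinor] at hF
  have hv := Matrix.eq_zero_of_mulVec_eq_zero (v := fun e' : Exponents n ((n + 1) * d) =>
    ∏ i, y i ^ e'.1 i) hF ?_
  · obtain ⟨i, hi⟩ := Function.ne_iff.1 hy
    have hmem : Finsupp.single i ((n + 1) * d) ∈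
        Finset.finsuppAntidiag (Finset.univ : Finset (Fin (n + 1))) ((n + 1) * d) := by
      rw [Finset.mem_finsuppAntidiag, ← Finsupp.degree_eq_sum, Finsupp.degree_single]
      exact ⟨rfl, Finset.subset_univ _⟩
    have := congrFun hv ⟨_, hmem⟩
    simp only [Pi.zero_apply] at this
    rw [Finset.prod_eq_single i (fun j _ hj => by simp [hj.symm]) (by simp),
      Finsupp.single_eq_same] at this
    exact hi (eq_zero_of_pow_eq_zero this)
  · ext e
    set i := bigVariable n d e with hi
    have hsub : (e.1 - Finsupp.single i d).degree + d = (n + 1) * d := by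
      have h1 : e.1.degree = (n + 1) * d := by
        rw [Finsupp.degree_eq_sum]
        exact (Finset.mem_finsuppAntidiag.1 e.2).1
      have h2 := congrArg Finsupp.degree (tsub_add_cancel_of_le (single_bigVariable_le n d e))
      rw [map_add, Finsupp.degree_single] at h2
      exact h2.trans h1
    have hhom : (monomial (e.1 - Finsupp.single i d) (1 : k) *
        (F i : MvPolynomial (Fin (n + 1)) k)).IsHomogeneous ((n + 1) * d) := by
      have h := (isHomogeneous_monomial (1 : k)
        (rfl : (e.1 - Finsupp.single i d).degree = _)).mul (F i).2
      exact Eq.mp (congrArg (IsHomogeneous _) hsub) h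
    have heval : eval y (monomial (e.1 - Finsupp.single i d) (1 : k) *
        (F i : MvPolynomial (Fin (n + 1)) k)) = 0 := by
      have : eval y (F i : MvPolynomial (Fin (n + 1)) k) = 0 := congrFun hzero i
      rw [map_mul, this, mul_zero]
    rw [eval_eq'] at heval
    simp only [Matrix.mulVec, dotProduct, Matrix.of_apply, coeffMulFunctional, LinearMap.coe_mk,
      AddHom.coe_mk, Pi.zero_apply]
    rw [← heval, Finset.sum_coe_sort (Finset.finsuppAntidiag Finset.univ ((n + 1) * d))
      (fun e' => coeff e' (monomial (e.1 - Finsupp.single i d) (1 : k) *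
        (F i : MvPolynomial (Fin (n + 1)) k)) * ∏ l, y l ^ e' l)]
    refine (Finset.sum_subset ?_ ?_).symm
    · intro e' he'
      rw [Finset.mem_finsuppAntidiag]
      refine ⟨?_, Finset.subset_univ _⟩
      have := hhom (mem_support_iff.1 he')
      rw [← Finsupp.degree_eq_sum, Finsupp.degree_eq_weight_one]
      exact this
    · intro e' _ he'
      rw [notMem_support_iff.1 he', zero_mul]

/-! ### The system of equations for a periodic critical orbit -/

section system

variable {k : Type*} [Field k] {n d : ℕ}

/-- The directional derivative of the polynomial `p` at `x` along `w`. -/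
noncomputable def dirDeriv {B : Type*} [CommRing B] [Algebra k B]
    (p : MvPolynomial (Fin (n + 1)) k) (x w : Fin (n + 1) → B) : B :=
  ∑ l, w l * aeval x (pderiv l p)

theorem map_dirDeriv {B B' : Type*} [CommRing B] [Algebra k B] [CommRing B'] [Algebra k B']
    (f : B →ₐ[k] B') (p : MvPolynomial (Fin (n + 1)) k) (x w : Fin (n + 1) → B) :
    f (dirDeriv p x w) = dirDeriv p (fun l => f (x l)) (fun l => f (w l)) := by
  simp only [dirDeriv, map_sum, map_mul]
  refine Finset.sum_congr rfl fun l _ => ?_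
  rw [← AlgHom.comp_apply, comp_aeval]

/-- The `i`-th component of the tuple `v + t • h + e • g` at `x`, over an algebra. -/
noncomputable def familyValue {B : Type*} [CommRing B] [Algebra k B] (v h g : FormTuple k n d)
    (t e : B) (x : Fin (n + 1) → B) (i : Fin (n + 1)) : B :=
  aeval x (v i : MvPolynomial (Fin (n + 1)) k) + t * aeval x (h i : MvPolynomial (Fin (n + 1)) k) +
    e * aeval x (g i : MvPolynomial (Fin (n + 1)) k)

/-- The derivative at `x` along `w` of the `i`-th component of the tuple `v + t • h + e • g`. -/
noncomputable def familyDeriv {B : Type*} [CommRing B] [Algebra k B] (v h g : FormTuple k n d)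
    (t e : B) (x w : Fin (n + 1) → B) (i : Fin (n + 1)) : B :=
  dirDeriv (v i : MvPolynomial (Fin (n + 1)) k) x w +
    t * dirDeriv (h i : MvPolynomial (Fin (n + 1)) k) x w +
    e * dirDeriv (g i : MvPolynomial (Fin (n + 1)) k) x w

/-- The unknowns (and the equations) of the system: an orbit of length `s` of vectors, and a
kernel vector, whose `z`-th coordinate is replaced by the parameter `t`. -/
abbrev OrbitIndex (n s : ℕ) : Type := (ZMod s × Fin (n + 1)) ⊕ Fin (n + 1)

/-- The residual of the equations expressing that the first `s` vectors form a periodic orbit of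
`v + t • h + e • g` whose first point is critical. -/
noncomputable def orbitResidual {B : Type*} [CommRing B] [Algebra k B] (z : Fin (n + 1)) (s : ℕ)
    (v h g : FormTuple k n d) (e : B) (y : OrbitIndex n s → B) : OrbitIndex n s → B
  | Sum.inl (j, i) => familyValue v h g (y (Sum.inr z)) e (fun l => y (Sum.inl (j, l))) i -
      y (Sum.inl (j + 1, i))
  | Sum.inr i => familyDeriv v h g (y (Sum.inr z)) e (fun l => y (Sum.inl (0, l)))
      (fun l => if l = z then 1 else y (Sum.inr l)) i

/-- Because the residual makes sense over every algebra, the same system can be read over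
polynomials, dual numbers, power series and `k`. -/
theorem map_orbitResidual {B B' : Type*} [CommRing B] [Algebra k B] [CommRing B'] [Algebra k B']
    (f : B →ₐ[k] B') (z : Fin (n + 1)) (s : ℕ) (v h g : FormTuple k n d) (e : B)
    (y : OrbitIndex n s → B) (c : OrbitIndex n s) :
    f (orbitResidual z s v h g e y c) = orbitResidual z s v h g (f e) (fun c => f (y c)) c := by
  have hval : ∀ (p : MvPolynomial (Fin (n + 1)) k) (x : Fin (n + 1) → B),
      f (aeval x p) = aeval (fun l => f (x l)) p := by
    intro p x
    rw [← AlgHom.comp_apply, comp_aeval]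
  rcases c with ⟨j, i⟩ | i
  · simp only [orbitResidual, familyValue, map_sub, map_add, map_mul, hval]
  · simp only [orbitResidual, familyDeriv, map_add, map_mul, map_dirDeriv, apply_ite f, map_one]

/-- The polynomials of the system of equations for a periodic critical orbit. -/
noncomputable def orbitEquation (z : Fin (n + 1)) (s : ℕ) (v h g : FormTuple k n d)
    (c : OrbitIndex n s) : MvPolynomial (Option (OrbitIndex n s)) k :=
  orbitResidual z s v h g (X none) (fun c => X (some c)) c

theorem aeval_orbitEquation {B : Type*} [CommRing B] [Algebra k B] (z : Fin (n + 1)) (s : ℕ)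
    (v h g : FormTuple k n d) (c : OrbitIndex n s) (f : Option (OrbitIndex n s) → B) :
    aeval f (orbitEquation z s v h g c) =
      orbitResidual z s v h g (f none) (fun c => f (some c)) c := by
  rw [orbitEquation, map_orbitResidual]
  simp

/-! ### The special family -/

/-- The tuple with components `x_i ^ d` for `i ≠ z` and `x_z ^ d - d x_o ^ (d-1) x_z`. -/
noncomputable def baseTuple (k : Type*) [Field k] {n d : ℕ} (hd : 2 ≤ d) (o z : Fin (n + 1)) :
    FormTuple k n d := fun i =>
  if i = z then
    ⟨X z ^ d - C (d : k) * (X o ^ (d - 1) * X z), by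
      refine (isHomogeneous_X_pow z d).sub (IsHomogeneous.C_mul ?_ _)
      have := (isHomogeneous_X_pow (R := k) o (d - 1)).mul (isHomogeneous_X k z)
      rwa [Nat.sub_add_cancel (by omega : 1 ≤ d)] at this⟩
  else ⟨X i ^ d, isHomogeneous_X_pow i d⟩

/-- The tuple with only nonzero component `x_o ^ d`, at `z`. -/
noncomputable def directionTuple (k : Type*) [Field k] {n d : ℕ} (o z : Fin (n + 1)) :
    FormTuple k n d := fun i => if i = z then ⟨X o ^ d, isHomogeneous_X_pow o d⟩ else 0

variable {B : Type*} [CommRing B] [Algebra k B]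

theorem familyValue_special_ne (hd : 2 ≤ d) {o z i : Fin (n + 1)} (hi : i ≠ z)
    (g : FormTuple k n d) (t : B) (x : Fin (n + 1) → B) :
    familyValue (baseTuple k hd o z) (directionTuple k o z) g t 0 x i = x i ^ d := by
  simp [familyValue, baseTuple, directionTuple, hi]

theorem familyValue_special_eq (hd : 2 ≤ d) {o z : Fin (n + 1)}
    (g : FormTuple k n d) (t : B) (x : Fin (n + 1) → B) :
    familyValue (baseTuple k hd o z) (directionTuple k o z) g t 0 x z =
      x z ^ d - d * (x o ^ (d - 1) * x z) + t * x o ^ d := by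
  simp [familyValue, baseTuple, directionTuple]

theorem familyDeriv_special_ne (hd : 2 ≤ d) {o z i : Fin (n + 1)} (hi : i ≠ z)
    (g : FormTuple k n d) (t : B) (x w : Fin (n + 1) → B) :
    familyDeriv (baseTuple k hd o z) (directionTuple k o z) g t 0 x w i =
      d * x i ^ (d - 1) * w i := by
  simp only [familyDeriv, dirDeriv, baseTuple, directionTuple, hi, if_false, zero_mul, add_zero]
  rw [Finset.sum_eq_single i]
  · simp [Derivation.leibniz_pow]
    ring
  · intro l _ hl
    simp [Derivation.leibniz_pow, pderiv_X_of_ne hl.symm]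
  · simp

/-- The coefficient `c` may stay unspecified: it multiplies `w o`, which vanishes at the base point
and in every tangent vector. -/
theorem familyDeriv_special_eq (hd : 2 ≤ d) {o z : Fin (n + 1)} (hoz : o ≠ z)
    (g : FormTuple k n d) (t : B) (x w : Fin (n + 1) → B) :
    ∃ c : B, familyDeriv (baseTuple k hd o z) (directionTuple k o z) g t 0 x w z =
      d * (x z ^ (d - 1) - x o ^ (d - 1)) * w z + c * w o := by
  refine ⟨aeval x (pderiv o (X z ^ d - C (d : k) * (X o ^ (d - 1) * X z))) +
    t * aeval x (pderiv o (X o ^ d : MvPolynomial (Fin (n + 1)) k)), ?_⟩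
  simp only [familyDeriv, dirDeriv, baseTuple, directionTuple, if_true, zero_mul, add_zero]
  rw [Finset.sum_eq_add z o hoz.symm, Finset.sum_eq_single o]
  · have : aeval x (pderiv z (X z ^ d - C (d : k) * (X o ^ (d - 1) * X z))) =
        (d : B) * (x z ^ (d - 1) - x o ^ (d - 1)) := by
      simp [Derivation.leibniz_pow, pderiv_X_of_ne hoz]
      ring
    rw [this]
    ring
  · intro l _ hl
    simp [Derivation.leibniz_pow, pderiv_X_of_ne hl.symm]
  · simp
  · intro l _ hl
    simp [Derivation.leibniz_pow, pderiv_X_of_ne hl.1.symm, pderiv_X_of_ne hl.2.symm]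
  · simp
  · simp

end system

/-! ### The base solution and its infinitesimal rigidity -/

section basePoint

variable {k : Type*} [Field k] {n d : ℕ}

/-- The periodic critical orbit of the special family at the parameter `t`. -/
noncomputable def basePoint (d : ℕ) (z : Fin (n + 1)) (s : ℕ) (t : k) : OrbitIndex n s → k
  | Sum.inl (j, i) => if i = z then Polynomial.aeval t (critOrbit d j.val) else 1
  | Sum.inr i => if i = z then t else 0

theorem aeval_critOrbit_periodic (d s : ℕ) (t : k)
    (ht : Polynomial.aeval t (critOrbit d s) = 1) :
    Function.Periodic (fun m => Polynomial.aeval t (critOrbit d m)) s := by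
  intro m
  induction m with
  | zero => simpa [critOrbit] using ht
  | succ m ih =>
    simp only at ih
    simp only [Nat.add_right_comm m 1 s, critOrbit, map_add, map_sub,
      map_mul, map_pow, ih]

theorem orbitResidual_basePoint (hd : 2 ≤ d) {o z : Fin (n + 1)} (hoz : o ≠ z) (s : ℕ) [NeZero s]
    (g : FormTuple k n d) (t : k) (ht : Polynomial.aeval t (critOrbit d s) = 1)
    (c : OrbitIndex n s) :
    orbitResidual z s (baseTuple k hd o z) (directionTuple k o z) g (0 : k)
      (basePoint d z s t) c = 0 := by
  rcases c with ⟨j, i⟩ | i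
  · simp only [orbitResidual]
    by_cases hi : i = z
    · subst hi
      rw [familyValue_special_eq]
      -- Periodicity accounts for the wrap-around of `j + 1` in `ZMod s`.
      have h1 := (aeval_critOrbit_periodic d s t ht).map_mod_nat (j.val + 1)
      have h2 : (j + 1).val = (j.val + 1) % s := by
        rw [ZMod.val_add, ZMod.val_one_eq_one_mod, Nat.add_mod_mod]
      simp only [basePoint, if_true, hoz, if_false, h2, h1, critOrbit, map_add, map_sub,
        map_mul, map_pow, map_natCast, Polynomial.aeval_X]
      ring
    · rw [familyValue_special_ne hd hi]
      simp [basePoint, hi]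
  · simp only [orbitResidual]
    by_cases hi : i = z
    · subst hi
      obtain ⟨c, hc⟩ := familyDeriv_special_eq hd hoz g (basePoint d i s t (Sum.inr i))
        (fun l => basePoint d i s t (Sum.inl (0, l)))
        (fun l => if l = i then 1 else basePoint d i s t (Sum.inr l))
      rw [hc]
      simp [basePoint, hoz, critOrbit]
    · rw [familyDeriv_special_ne hd hi]
      simp [basePoint, hi]

theorem eq_pow_mul_of_add_one {s : ℕ} {R : Type*} [CommRing R] (a : R) (x : ZMod s → R)
    (hx : ∀ j, x (j + 1) = a * x j) (m : ℕ) : x m = a ^ m * x 0 := by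
  induction m with
  | zero => simp
  | succ m ih => rw [Nat.cast_succ, hx, ih, pow_succ]; ring

/-- The system has no nonzero tangent vector at the base point. -/
theorem tangent_basePoint_eq_zero [CharZero k] (hd : 2 ≤ d) {o z : Fin (n + 1)} (hoz : o ≠ z)
    (s : ℕ) [NeZero s] (g : FormTuple k n d) (t : k)
    (ht' : Polynomial.aeval t (Polynomial.derivative (critOrbit d s)) ≠ 0)
    (ht : Polynomial.aeval t (critOrbit d s) = 1)
    (b : OrbitIndex n s → k)
    (hb : ∀ c, orbitResidual z s (baseTuple k hd o z) (directionTuple k o z) g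
      (0 : DualNumber k) (fun c => TrivSqZeroExt.inl (basePoint d z s t c) +
        TrivSqZeroExt.inr (b c)) c = 0) : b = 0 := by
  have hs0 : s ≠ 0 := NeZero.ne s
  -- coordinates other than `z` of the orbit
  have hx : ∀ i, i ≠ z → ∀ j, b (Sum.inl (j, i)) = 0 := by
    intro i hi
    have hrec : ∀ j : ZMod s, b (Sum.inl (j + 1, i)) = d * b (Sum.inl (j, i)) := by
      intro j
      have := congrArg TrivSqZeroExt.snd (hb (Sum.inl (j, i)))
      simp only [orbitResidual] at this
      rw [familyValue_special_ne hd hi] at this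
      simp [basePoint, hi, TrivSqZeroExt.snd_pow] at this
      linear_combination -this
    have hpow := eq_pow_mul_of_add_one (d : k) (fun j : ZMod s => b (Sum.inl (j, i))) hrec
    have h0 : b (Sum.inl (0, i)) = 0 := by
      have h1 := hpow s
      simp only [ZMod.natCast_self] at h1
      -- Going once around the cycle multiplies the tangent by `d ^ s`. This removes the scaling
      -- freedom of vectors representing projective points.
      have h2 : (d : k) ^ s ≠ 1 := by
        have : d ^ s ≠ 1 := (Nat.one_lt_pow hs0 (by omega)).ne'
        exact_mod_cast this
      have h3 : ((d : k) ^ s - 1) * b (Sum.inl (0, i)) = 0 := by linear_combination -h1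
      exact (mul_eq_zero.1 h3).resolve_left (sub_ne_zero.2 h2)
    intro j
    have h1 := hpow j.val
    simp only [ZMod.natCast_zmod_val] at h1
    rw [h1, h0, mul_zero]
  -- the kernel vector
  have hw : ∀ i, i ≠ z → b (Sum.inr i) = 0 := by
    intro i hi
    have := congrArg TrivSqZeroExt.snd (hb (Sum.inr i))
    simp only [orbitResidual] at this
    rw [familyDeriv_special_ne hd hi] at this
    simp [basePoint, hi, TrivSqZeroExt.snd_pow] at this
    exact this.resolve_right (by omega)
  -- the critical point
  have hz0 : b (Sum.inl (0, z)) = 0 := by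
    have := hb (Sum.inr z)
    simp only [orbitResidual] at this
    obtain ⟨c, hc⟩ := familyDeriv_special_eq (B := DualNumber k) hd hoz g
      (TrivSqZeroExt.inl (basePoint d z s t (Sum.inr z)) + TrivSqZeroExt.inr (b (Sum.inr z)))
      (fun l => TrivSqZeroExt.inl (basePoint d z s t (Sum.inl (0, l))) +
        TrivSqZeroExt.inr (b (Sum.inl (0, l))))
      (fun l => if l = z then 1 else TrivSqZeroExt.inl (basePoint d z s t (Sum.inr l)) +
        TrivSqZeroExt.inr (b (Sum.inr l)))
    rw [hc] at this
    have := congrArg TrivSqZeroExt.snd this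
    simp [basePoint, hoz, hx o hoz, hw o hoz, TrivSqZeroExt.snd_pow, critOrbit] at this
    -- The critical point `1` is simple: the second derivative there is `d * (d - 1) ≠ 0`.
    exact (this.resolve_left (by omega)).resolve_left (by omega)
  -- the moving coordinate of the orbit
  have hrec : ∀ m : ℕ, b (Sum.inl ((m : ZMod s), z)) =
      b (Sum.inr z) * Polynomial.aeval t (Polynomial.derivative (critOrbit d m)) := by
    intro m
    induction m with
    | zero => simp [hz0, critOrbit]
    | succ m ih =>
      have := congrArg TrivSqZeroExt.snd (hb (Sum.inl ((m : ZMod s), z)))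
      simp only [orbitResidual] at this
      rw [familyValue_special_eq] at this
      have hm := (aeval_critOrbit_periodic d s t ht).map_mod_nat m
      simp [basePoint, hoz, hx o hoz, TrivSqZeroExt.snd_pow, ZMod.val_natCast, hm, ih] at this
      simp [critOrbit, Polynomial.derivative_pow]
      linear_combination -this
  -- Closing the cycle at `m = s` forces the variation of `t` to vanish, since the root `t` is
  -- simple.
  have hbz : b (Sum.inr z) = 0 := by
    have := hrec s
    rw [ZMod.natCast_self, hz0] at this
    exact (mul_eq_zero.1 this.symm).resolve_right ht'
  funext c
  rcases c with ⟨j, i⟩ | i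
  · by_cases hi : i = z
    · subst hi
      have := hrec j.val
      rw [ZMod.natCast_zmod_val, hbz, zero_mul] at this
      exact this
    · exact hx i hi j
  · by_cases hi : i = z
    · subst hi
      exact hbz
    · exact hw i hi

end basePoint

/-! ### Critical cycles and density -/

section density

variable {k : Type*} [Field k] {n d : ℕ}

/-- A tuple of forms having a cycle of nonzero vectors through a point where its
derivative has a kernel. -/
def HasCriticalCycle (F : FormTuple k n d) : Prop :=
  ∃ (s : ℕ) (x : ZMod (s + 1) → Fin (n + 1) → k) (w : Fin (n + 1) → k), x 0 ≠ 0 ∧ w ≠ 0 ∧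
    (∀ j, F.value (x j) = x (j + 1)) ∧
    ∀ i, dirDeriv (F i : MvPolynomial (Fin (n + 1)) k) (x 0) w = 0

theorem hasCriticalCycle_of_orbitResidual (z o : Fin (n + 1)) (s : ℕ) (v h g : FormTuple k n d)
    (e : k) (y : OrbitIndex n (s + 1) → k)
    (hy : ∀ c, orbitResidual z (s + 1) v h g e y c = 0) (hyo : y (Sum.inl (0, o)) ≠ 0) :
    HasCriticalCycle (v + y (Sum.inr z) • h + e • g) := by
  refine ⟨s, fun j i => y (Sum.inl (j, i)), fun l => if l = z then 1 else y (Sum.inr l),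
    fun h0 => hyo (congrFun h0 o), fun h0 => by simpa using congrFun h0 z, ?_, ?_⟩
  · intro j
    funext i
    have := sub_eq_zero.1 (hy (Sum.inl (j, i)))
    refine Eq.trans ?_ this
    simp [FormTuple.value, familyValue, aeval_eq_eval]
  · intro i
    have := hy (Sum.inr i)
    simp only [orbitResidual] at this
    rw [← this]
    simp only [familyDeriv, dirDeriv, Finset.mul_sum, ← Finset.sum_add_distrib]
    refine Finset.sum_congr rfl fun l _ => ?_
    simp only [Pi.add_apply, Pi.smul_apply, Submodule.coe_add, SetLike.val_smul, map_add,
      Derivation.map_smul, map_smul, smul_eq_mul]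
    ring

open PowerSeries in
/-- A polynomial function vanishing at all tuples with a critical cycle vanishes on deformations
of the special family at infinitely many power series parameters. -/
theorem exists_powerSeries_evalFamily_eq_zero [IsAlgClosed k] [CharZero k] (hd : 2 ≤ d)
    {o z : Fin (n + 1)} (hoz : o ≠ z) (φ : MvPolynomial (Module.Dual k (FormTuple k n d)) k)
    (hφ : ∀ F, HasCriticalCycle F → evalDual φ F = 0) (g : FormTuple k n d) (s : ℕ) (t : k)
    (ht : Polynomial.aeval t (critOrbit d (s + 1)) = 1) :
    ∃ T : PowerSeries k, constantCoeff T = t ∧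
      evalFamily φ (baseTuple k hd o z) (directionTuple k o z) g T PowerSeries.X = 0 := by
  have ht' := aeval_derivative_critOrbit_ne_zero d hd s t ht
  obtain ⟨u, hu, hG⟩ := exists_powerSeries_zero
    (orbitEquation z (s + 1) (baseTuple k hd o z) (directionTuple k o z) g)
    (basePoint d z (s + 1) t)
    (fun c => by
      rw [aeval_orbitEquation]
      exact orbitResidual_basePoint hd hoz (s + 1) g t ht c)
    (fun b hb => tangent_basePoint_eq_zero hd hoz (s + 1) g t ht' ht b fun c => by
      have := hb c
      rw [aeval_orbitEquation] at this
      exact this)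
  refine ⟨u (Sum.inr z), by rw [hu]; simp [basePoint], ?_⟩
  by_contra hne
  let r : Option (OrbitIndex n (s + 1)) → PowerSeries k := fun c => c.elim PowerSeries.X u
  -- The second factor, with constant term `1` along the lift, keeps the first orbit vector nonzero
  -- after specialization.
  let H : MvPolynomial (Option (OrbitIndex n (s + 1))) k :=
    evalFamily φ (baseTuple k hd o z) (directionTuple k o z) g
      (MvPolynomial.X (some (Sum.inr z))) (MvPolynomial.X none) *
      MvPolynomial.X (some (Sum.inl (0, o)))
  have hH : MvPolynomial.aeval r H ≠ 0 := by
    simp only [H, map_mul, map_evalFamily, MvPolynomial.aeval_X]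
    refine mul_ne_zero hne fun h0 => ?_
    have := hu (Sum.inl (0, o))
    change u (Sum.inl (0, o)) = 0 at h0
    rw [h0] at this
    simp [basePoint, hoz] at this
  obtain ⟨y, hyH, hy⟩ := exists_specialization r H hH
  simp only [H, map_mul, map_evalFamily, MvPolynomial.aeval_X] at hyH
  rw [evalFamily_eq_evalDual] at hyH
  refine left_ne_zero_of_mul hyH (hφ _ ?_)
  refine hasCriticalCycle_of_orbitResidual z o s _ _ g (y none) (fun c => y (some c)) (fun c => ?_)
    (right_ne_zero_of_mul hyH)
  rw [← aeval_orbitEquation]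
  exact hy _ (hG c)

/-- Tuples with a critical cycle are Zariski dense in the vector space of all tuples. -/
theorem evalDual_eq_zero_of_hasCriticalCycle [IsAlgClosed k] [CharZero k] (hn : 1 ≤ n)
    (hd : 2 ≤ d) (φ : MvPolynomial (Module.Dual k (FormTuple k n d)) k)
    (hφ : ∀ F, HasCriticalCycle F → evalDual φ F = 0) (F : FormTuple k n d) :
    evalDual φ F = 0 := by
  have hoz : (0 : Fin (n + 1)) ≠ Fin.last n := by
    rw [Ne, Fin.ext_iff]
    simp
    omega
  set v := baseTuple k hd 0 (Fin.last n)
  set h : FormTuple k n d := directionTuple k 0 (Fin.last n)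
  set g := F - v with hg
  let P : Polynomial (PowerSeries k) :=
    evalFamily φ v h g Polynomial.X (Polynomial.C PowerSeries.X)
  have hPeval : ∀ T : PowerSeries k, P.eval T = evalFamily φ v h g T PowerSeries.X := by
    intro T
    have := map_evalFamily ((Polynomial.aeval T : Polynomial (PowerSeries k) →ₐ[PowerSeries k]
      PowerSeries k).restrictScalars k) φ v h g Polynomial.X (Polynomial.C PowerSeries.X)
    simpa [P, Polynomial.coe_aeval_eq_eval] using this
  have hP : P = 0 := by
    refine Polynomial.eq_zero_of_infinite_isRoot P fun hfin => ?_
    refine infinite_critOrbit_periodic k d hd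
      ((hfin.image (PowerSeries.constantCoeff (R := k))).subset ?_)
    rintro t ⟨s, hs⟩
    obtain ⟨T, hT, hT0⟩ := exists_powerSeries_evalFamily_eq_zero hd hoz φ hφ g s t hs
    exact ⟨T, (hPeval T).trans hT0, hT⟩
  have h0 : evalFamily φ v h g (0 : PowerSeries k) PowerSeries.X = 0 := by
    rw [← hPeval, hP, Polynomial.eval_zero]
  -- Power series cannot be evaluated at `1`; with `T = 0` the series is a polynomial in `e`, so the
  -- identity descends to `k[e]`.
  have h1 : evalFamily φ v h g (0 : Polynomial k) Polynomial.X = 0 := by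
    refine Polynomial.coe_injective k ?_
    have := map_evalFamily (Polynomial.coeToPowerSeries.algHom (R := k) k) φ v h g 0 Polynomial.X
    simp only [Polynomial.coeToPowerSeries.algHom_apply, Algebra.algebraMap_self, map_zero,
      PowerSeries.map_id, Polynomial.coe_X, id_eq] at this
    rw [this, h0, Polynomial.coe_zero]
  have h2 := map_evalFamily (Polynomial.aeval (1 : k)) φ v h g 0 Polynomial.X
  rw [h1, map_zero, Polynomial.aeval_X, evalFamily_eq_evalDual] at h2
  rw [h2, hg]
  simp

theorem jacobian_eval_eq_zero (F : FormTuple k n d) (x w : Fin (n + 1) → k) (hw : w ≠ 0)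
    (h : ∀ i, dirDeriv (F i : MvPolynomial (Fin (n + 1)) k) x w = 0) :
    eval x F.jacobian = 0 := by
  rw [FormTuple.jacobian, RingHom.map_det]
  refine Matrix.exists_mulVec_eq_zero_iff.1 ⟨w, hw, ?_⟩
  funext i
  rw [Pi.zero_apply, ← h i]
  simp only [Matrix.mulVec, dotProduct, dirDeriv, RingHom.mapMatrix_apply, Matrix.map_apply,
    Matrix.of_apply, aeval_eq_eval]
  exact Finset.sum_congr rfl fun l _ => mul_comm _ _

/-- An endomorphism represented by a tuple with a critical cycle has a periodic critical point. -/
theorem exists_isCritical_isPeriodic (f : EndP k n d) (F : FormTuple k n d) (hF : F ≠ 0)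
    (hf : Projectivization.mk k F hF = f.1) (hc : HasCriticalCycle F) :
    ∃ P : ℙ k (Fin (n + 1) → k), f.IsCritical P ∧ f.IsPeriodic P := by
  obtain ⟨s, x, w, hx0, hw, hx, hker⟩ := hc
  have hiter : ∀ m : ℕ, ∃ hm : x m ≠ 0,
      f.toMap^[m] (Projectivization.mk k (x 0) hx0) = Projectivization.mk k (x m) hm := by
    intro m
    induction m with
    | zero => exact ⟨by simpa using hx0, by simp⟩
    | succ m ih =>
      obtain ⟨hm, ih⟩ := ih
      have hne := value_ne_zero_of_mk f F hF hf (x m) hm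
      refine ⟨by rw [Nat.cast_succ, ← hx]; exact hne, ?_⟩
      rw [Function.iterate_succ_apply', ih, EndP.toMap_mk f F hF hf]
      simp only [hx, Nat.cast_succ]
  refine ⟨Projectivization.mk k (x 0) hx0, ?_, s + 1, by omega, ?_⟩
  · rw [EndP.isCritical_mk f F hF hf]
    exact jacobian_eval_eq_zero F (x 0) w hw hker
  · obtain ⟨hm, h⟩ := hiter (s + 1)
    rw [h]
    simp only [ZMod.natCast_self]

/-- A closed subset of the space of endomorphisms is cut out by homogeneous polynomials. -/
theorem exists_homogeneous_of_isClosed {Z : Set (EndP k n d)} (hZ : IsClosed Z) :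
    ∃ S : Set (MvPolynomial (Module.Dual k (FormTuple k n d)) k),
      (∀ φ ∈ S, ∃ m, φ.IsHomogeneous m) ∧ ∀ f : EndP k n d, f ∈ Z ↔ f.1 ∈ zeroLocus S := by
  obtain ⟨Y, hY, rfl⟩ := (@isClosed_induced_iff _ _ (zariskiTopology k (FormTuple k n d)) _ _).1 hZ
  have hY' := hY.isOpen_compl
  obtain ⟨S, hS, hYS⟩ := hY'
  rw [compl_compl] at hYS
  exact ⟨S, hS, fun f => by rw [← hYS]; rfl⟩

end density

end ProjDyn

theorem theorem3 {k : Type*} [Field k] [IsAlgClosed k] [CharZero k] (n d : ℕ)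
    (hn : 1 ≤ n) (hd : 2 ≤ d) :
    Dense {f : ProjDyn.EndP k n d |
      ∃ P : ℙ k (Fin (n + 1) → k), f.IsCritical P ∧ f.IsPeriodic P} := by
  intro f
  obtain ⟨S, hS, hmem⟩ := ProjDyn.exists_homogeneous_of_isClosed (isClosed_closure (s :=
    {f : ProjDyn.EndP k n d | ∃ P : ℙ k (Fin (n + 1) → k), f.IsCritical P ∧ f.IsPeriodic P}))
  rw [hmem]
  intro φ hφS
  by_contra hφf
  obtain ⟨F, hF⟩ := ProjDyn.exists_evalDual_mul_ne_zero φ (ProjDyn.macaulayMinor k n d) f.1.rep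
    (ProjDyn.powerTuple k n d) hφf (ProjDyn.evalDual_macaulayMinor_powerTuple k n d)
  refine hF (ProjDyn.evalDual_eq_zero_of_hasCriticalCycle hn hd _ (fun G hG => ?_) F)
  rw [ProjDyn.evalDual, map_mul]
  -- If the minor vanishes at `G`, so does the product; otherwise `G` defines an endomorphism in the
  -- set, where `φ` vanishes.
  by_cases hM : ProjDyn.evalDual (ProjDyn.macaulayMinor k n d) G = 0
  · exact mul_eq_zero_of_right _ hM
  refine mul_eq_zero_of_left ?_ _
  have hval := ProjDyn.value_ne_zero_of_macaulayMinor G hM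
  have hG0 : G ≠ 0 := by
    rintro rfl
    refine hval (fun _ => 1) (fun h => one_ne_zero (congrFun h 0)) ?_
    funext i
    simp [ProjDyn.FormTuple.value]
  let e : ProjDyn.EndP k n d := ⟨Projectivization.mk k G hG0, by
    intro x hx
    obtain ⟨a, ha⟩ := Projectivization.exists_smul_eq_mk_rep k G hG0
    rw [← ha, Units.smul_def, ProjDyn.FormTuple.smul_value]
    exact smul_ne_zero a.ne_zero (hval x hx)⟩
  have he := (hmem e).1 (subset_closure
    (ProjDyn.exists_isCritical_isPeriodic e G hG0 rfl hG))
  exact (ProjDyn.mk_mem_zeroLocus hS G hG0).1 he φ hφS
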